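/- Let $E$ be a complex Banach space and let $U(t)=e^{tD}$, $t\in\mathbb{R}$, be a strongly continuous one-parameter group of bounded linear operators in $E$ which is bounded, $\sup_{t\in\mathbb{R}}\|U(t)\|<\infty$, with infinitesimal generator $D$. For $\sigma>0$ let $\mathbf{B}_\sigma(D)$ be the set of all $f\in E$ that lie in the domain of $D^k$ for every $k\in\mathbb{N}$ and satisfy $\|D^kf\|\le\sigma^k\|f\|$ for every $k\in\mathbb{N}$. Let $\operatorname{sinc}$ be the entire function $\operatorname{sinc}w=\frac{\sin \pi w}{\pi w}$, $\operatorname{sinc}0=1$. Let $\sigma>0$ and $f\in\mathbf{B}_\sigma(D)$. Then the series $$e^{zD}f=\sum_{r=0}^\infty\frac{z^r}{r!}D^rf$$ converges in $E$ for every $z\in\mathbb{C}$, and $z\mapsto e^{zD}f$ is an entire $E$-valued function that coincides with $U(t)f$ at real $z=t$. Moreover, for every $z\in\mathbb{C}$ the series below converges unconditionally in $E$ and $$e^{zD}f=z\,\operatorname{sinc}\!\left(\frac{\sigma z}{\pi}\right)Df+\operatorname{sinc}\!\left(\frac{\sigma z}{\pi}\right)f+\sum_{k\in\mathbb{Z},\,k\neq0}\frac{\sigma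 z}{k\pi}\,\operatorname{sinc}\!\left(\frac{\sigma z}{\pi}-k\right)e^{\frac{k\pi}{\sigma}D}f.$$ -/

import Mathlib

/-- A one-parameter strongly continuous bounded group `U t = e^{tD}`, `t ∈ ℝ`, of bounded linear
operators in a complex Banach space. -/
structure IsBoundedC0Group {E : Type*} [NormedAddCommGroup E] [NormedSpace ℂ E]
    (U : ℝ → E →L[ℂ] E) : Prop where
  map_zero : U 0 = ContinuousLinearMap.id ℂ E
  map_add : ∀ s t : ℝ, U (s + t) = (U s).comp (U t)
  strongly_continuous : ∀ f : E, Continuous fun t : ℝ => U t f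
  bounded : ∃ M : ℝ, ∀ t : ℝ, ‖U t‖ ≤ M

/-- The infinitesimal generator `D` of `U`: its domain consists of the vectors `f` for which
`t ↦ U t f` is differentiable at `0`, and `D f` is that derivative. -/
noncomputable def generator {E : Type*} [NormedAddCommGroup E] [NormedSpace ℂ E]
    (U : ℝ → E →L[ℂ] E) : E →ₗ.[ℂ] E where
  domain :=
    { carrier := {f | DifferentiableAt ℝ (fun t : ℝ => U t f) 0}
      add_mem' := fun {f g} hf hg => by
        have hf' : DifferentiableAt ℝ (fun t : ℝ => U t f) 0 := hf
        have hg' : DifferentiableAt ℝ (fun t : ℝ => U t g) 0 := hg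
        simpa using hf'.fun_add hg'
      zero_mem' := by simp
      smul_mem' := fun c f hf => by
        have hf' : DifferentiableAt ℝ (fun t : ℝ => U t f) 0 := hf
        simpa using hf'.fun_const_smul c }
  toFun :=
    { toFun := fun f => deriv (fun t : ℝ => U t (f : E)) 0
      map_add' := fun f g => by
        have hf : DifferentiableAt ℝ (fun t : ℝ => U t (f : E)) 0 := f.2
        have hg : DifferentiableAt ℝ (fun t : ℝ => U t (g : E)) 0 := g.2
        simpa using deriv_fun_add hf hg
      map_smul' := fun c f => by
        have hf : DifferentiableAt ℝ (fun t : ℝ => U t (f : E)) 0 := f.2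
        simpa using deriv_fun_const_smul c hf }

open Classical in
/-- The value `D f` of an operator `D` with domain; by convention `0` for `f` outside the domain. -/
noncomputable def opApply {E : Type*} [AddCommGroup E] [Module ℂ E]
    (D : E →ₗ.[ℂ] E) (f : E) : E :=
  if h : f ∈ D.domain then D ⟨f, h⟩ else 0

/-- The vector `D ^ k f` (meaningful for `f` in the domain of `D ^ k`). -/
noncomputable def opPow {E : Type*} [AddCommGroup E] [Module ℂ E]
    (D : E →ₗ.[ℂ] E) (k : ℕ) (f : E) : E :=
  (opApply D)^[k] f

/-- The domain of `D ^ k`: `D ^ 0` is defined everywhere, and `f` is in the domain of `D ^ (k + 1)`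
when `f` is in the domain of `D` and `D f` is in the domain of `D ^ k`. -/
def powDomain {E : Type*} [AddCommGroup E] [Module ℂ E] (D : E →ₗ.[ℂ] E) : ℕ → Set E
  | 0 => Set.univ
  | k + 1 => {f | ∃ h : f ∈ D.domain, D ⟨f, h⟩ ∈ powDomain D k}

/-- The Bernstein subspace `B_σ(D)`: the vectors `f` in the domain of all powers of `D` with
`‖D ^ k f‖ ≤ σ ^ k ‖f‖` for all `k`. -/
def bernsteinSpace {E : Type*} [NormedAddCommGroup E] [NormedSpace ℂ E]
    (D : E →ₗ.[ℂ] E) (σ : ℝ) : Set E :=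
  {f | (∀ k : ℕ, f ∈ powDomain D k) ∧ ∀ k : ℕ, ‖opPow D k f‖ ≤ σ ^ k * ‖f‖}

/-- The trajectory `e^{zD} f = ∑ r, z ^ r D ^ r f / r!` at complex `z`. -/
noncomputable def expOp {E : Type*} [NormedAddCommGroup E] [NormedSpace ℂ E]
    (D : E →ₗ.[ℂ] E) (z : ℂ) (f : E) : E :=
  ∑' r : ℕ, (z ^ r / (Nat.factorial r : ℂ)) • opPow D r f

/-- The normalized sinc function `sinc w = sin (π w) / (π w)`, `sinc 0 = 1`, on `ℂ`. -/
noncomputable def csinc (w : ℂ) : ℂ :=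
  if w = 0 then 1 else Complex.sin ((Real.pi : ℂ) * w) / ((Real.pi : ℂ) * w)

/-! For a Bernstein vector the power series of `e^{zD} f` is dominated by that of `exp (σ‖z‖)`, so
it is entire. It equals `U t f` on the real line, and the identity theorem extends the group law to
`e^{(t+z)D} f = U t (e^{zD} f)`. Boundedness of the group then gives growth `O(exp (σ |Im z|))`
(`exists_norm_expOp_le`). After rescaling, everything reduces to a sampling formula for entire
functions `g` with `‖g w‖ ≤ C exp (π |Im w|)`.

Such a `g` need not decay on the real line, so its plain sinc series may diverge. Instead one
expands `h w = (g w - csinc w • g 0) / w`, which is `O(1/|x|)` there, and multiplies back by `w`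
(`sampling_formula`). For `h`, the difference from its sinc series vanishes on `ℤ`, hence is `sin (π
w) • H w` with `H` entire. `H` grows polynomially and tends to `0` up the imaginary axis, so it
vanishes by a Liouville argument (`hasSum_csinc_smul`). -/

/-! ### Upper and lower bounds for the sine -/

open Complex in
theorem norm_sin_pi_mul_le (w : ℂ) : ‖sin (Real.pi * w)‖ ≤ Real.exp (Real.pi * |w.im|) := by
  have h1 : ‖cexp (-(Real.pi * w) * I)‖ ≤ Real.exp (Real.pi * |w.im|) := by
    rw [norm_exp]
    apply Real.exp_le_exp.2
    have : (-(Real.pi * w) * I).re = Real.pi * w.im := by simp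
    rw [this]
    exact mul_le_mul_of_nonneg_left (le_abs_self _) Real.pi_pos.le
  have h2 : ‖cexp (Real.pi * w * I)‖ ≤ Real.exp (Real.pi * |w.im|) := by
    rw [norm_exp]
    apply Real.exp_le_exp.2
    have : (Real.pi * w * I).re = Real.pi * (-w.im) := by simp
    rw [this]
    exact mul_le_mul_of_nonneg_left (neg_le_abs _) Real.pi_pos.le
  rw [sin, norm_div, norm_mul, norm_I, mul_one, norm_ofNat, div_le_iff₀ two_pos]
  linarith [norm_sub_le (cexp (-(Real.pi * w) * I)) (cexp (Real.pi * w * I))]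

/-- After clearing terms this is `1 + 2 * t ≤ exp (2 * t)`. -/
theorem mul_exp_le_sinh (t : ℝ) :
    t * Real.exp t ≤ (1 + 2 * t) * Real.sinh t := by
  have h1 : 2 * t + 1 ≤ Real.exp (2 * t) := Real.add_one_le_exp _
  have h2 : Real.exp (2 * t) = Real.exp t * Real.exp t := by rw [← Real.exp_add]; ring_nf
  have h3 : Real.exp t * Real.exp (-t) = 1 := by rw [← Real.exp_add]; simp
  have h4 : (1 + 2 * t) * Real.exp (-t) ≤ Real.exp t := by
    have := mul_le_mul_of_nonneg_right h1 (Real.exp_pos (-t)).le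
    rw [h2, mul_assoc, h3] at this
    linarith
  rw [Real.sinh_eq]
  nlinarith [Real.exp_pos t]

open Complex in
theorem sinh_pi_mul_abs_im_le_norm_sin (w : ℂ) :
    Real.sinh (Real.pi * |w.im|) ≤ ‖sin (Real.pi * w)‖ := by
  have h1 : ‖cexp (-(Real.pi * w) * I)‖ = Real.exp (Real.pi * w.im) := by
    rw [norm_exp]; simp
  have h2 : ‖cexp (Real.pi * w * I)‖ = Real.exp (-(Real.pi * w.im)) := by
    rw [norm_exp]; simp
  rw [sin, norm_div, norm_mul, norm_I, mul_one, norm_ofNat, Real.sinh_eq]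
  gcongr
  have h3 := abs_norm_sub_norm_le (cexp (-(Real.pi * w) * I)) (cexp (Real.pi * w * I))
  rw [h1, h2] at h3
  refine le_trans ?_ h3
  rcases abs_cases w.im with h | h <;> rw [h.1]
  · exact le_abs_self _
  · refine le_trans (le_of_eq ?_) (neg_le_abs _)
    ring_nf

/-- The factor `|Im w|` absorbs the zeros of the sine, giving a lower bound on the whole plane
without excising discs around the integers. -/
theorem abs_im_mul_exp_le (w : ℂ) :
    |w.im| * Real.exp (Real.pi * |w.im|) ≤
      (1 + 2 * (Real.pi * |w.im|)) * ‖Complex.sin (Real.pi * w)‖ := by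
  have h0 : 0 ≤ Real.pi * |w.im| := by positivity
  have h1 := mul_exp_le_sinh (Real.pi * |w.im|)
  have h2 : |w.im| ≤ Real.pi * |w.im| := by nlinarith [Real.pi_gt_three, abs_nonneg w.im]
  calc |w.im| * Real.exp (Real.pi * |w.im|)
      ≤ Real.pi * |w.im| * Real.exp (Real.pi * |w.im|) := by gcongr
    _ ≤ _ := h1
    _ ≤ _ := by gcongr; exact sinh_pi_mul_abs_im_le_norm_sin w

/-! ### Difference quotients and the sinc function -/

/-- The difference quotient at `0` of an entire function of exponential type `π`, bounded on
the real line, gains a factor `1 / (1 + ‖w‖)`. -/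
theorem exists_norm_dslope_le {F : Type*} [NormedAddCommGroup F] [NormedSpace ℂ F]
    [CompleteSpace F] {G : ℂ → F} (hG : Differentiable ℂ G) {C : ℝ}
    (hC : ∀ w, ‖G w‖ ≤ C * Real.exp (Real.pi * |w.im|)) :
    ∃ B : ℝ, 0 ≤ B ∧
      ∀ w, ‖dslope G 0 w‖ ≤ B * (Real.exp (Real.pi * |w.im|) / (1 + ‖w‖)) := by
  have hd : Differentiable ℂ (dslope G 0) := by
    rw [← differentiableOn_univ] at hG ⊢
    exact (Complex.differentiableOn_dslope Filter.univ_mem).2 hG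
  obtain ⟨A, hA⟩ := (isCompact_closedBall (0 : ℂ) 1).exists_bound_of_continuousOn
    hd.continuous.continuousOn
  have hC0 : 0 ≤ C := by have := (norm_nonneg _).trans (hC 0); simpa using this
  have hA0 : 0 ≤ A := (norm_nonneg _).trans (hA 0 (by simp))
  -- `2 * A` serves the unit disc, by compactness; `4 * C` serves its exterior, where `‖G w - G 0‖`
  -- costs a factor 2 and `(1 + ‖w‖) / ‖w‖` another.
  refine ⟨4 * C + 2 * A, by positivity, fun w => ?_⟩
  have he : 1 ≤ Real.exp (Real.pi * |w.im|) := Real.one_le_exp (by positivity)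
  rw [← mul_div_assoc, le_div_iff₀ (by positivity)]
  rcases le_total ‖w‖ 1 with hw | hw
  · have h1 := hA w (by simpa using hw)
    calc ‖dslope G 0 w‖ * (1 + ‖w‖) ≤ A * (1 + 1) := by gcongr
      _ ≤ (4 * C + 2 * A) * 1 := by linarith
      _ ≤ _ := by gcongr
  · have hw0 : w ≠ 0 := by rintro rfl; simp at hw; linarith
    rw [dslope_of_ne _ hw0, slope_def_module, sub_zero, norm_smul, norm_inv]
    have h0 : ‖G 0‖ ≤ C := by simpa using hC 0
    have h1 : ‖G w - G 0‖ ≤ 2 * C * Real.exp (Real.pi * |w.im|) := by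
      have := norm_sub_le (G w) (G 0)
      have := hC w
      nlinarith
    have h2 : ‖w‖⁻¹ * (1 + ‖w‖) ≤ 2 := by
      rw [inv_mul_le_iff₀ (by linarith)]; linarith
    calc ‖w‖⁻¹ * ‖G w - G 0‖ * (1 + ‖w‖) = ‖G w - G 0‖ * (‖w‖⁻¹ * (1 + ‖w‖)) := by ring
      _ ≤ 2 * C * Real.exp (Real.pi * |w.im|) * 2 := by gcongr
      _ ≤ _ := by nlinarith

/-- Makes the removable singularity at `0` automatic and gives both holomorphy and decay of `csinc`.
-/
theorem csinc_eq_dslope :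
    csinc = dslope (fun w : ℂ => Complex.sin (Real.pi * w) / Real.pi) 0 := by
  have hpi : (Real.pi : ℂ) ≠ 0 := by exact_mod_cast Real.pi_ne_zero
  funext w
  rcases eq_or_ne w 0 with rfl | hw
  · have h : HasDerivAt (fun w : ℂ => Complex.sin (Real.pi * w) / Real.pi)
        (Complex.cos (Real.pi * 0) * (Real.pi * 1) / Real.pi) 0 :=
      (((hasDerivAt_id (0 : ℂ)).const_mul (Real.pi : ℂ)).csin).div_const _
    rw [dslope_same, h.deriv]
    simp [csinc, hpi]
  · rw [dslope_of_ne _ hw, slope_def_module, csinc, if_neg hw]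
    simp
    field_simp

theorem differentiable_csinc : Differentiable ℂ csinc := by
  rw [csinc_eq_dslope, ← differentiableOn_univ, Complex.differentiableOn_dslope Filter.univ_mem]
  fun_prop

theorem exists_norm_csinc_le :
    ∃ B : ℝ, 0 ≤ B ∧ ∀ w, ‖csinc w‖ ≤ B * (Real.exp (Real.pi * |w.im|) / (1 + ‖w‖)) := by
  rw [csinc_eq_dslope]
  refine exists_norm_dslope_le (C := Real.pi⁻¹) (by fun_prop) fun w => ?_
  rw [norm_div, div_eq_inv_mul, Complex.norm_real, Real.norm_of_nonneg Real.pi_pos.le]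
  gcongr
  exact norm_sin_pi_mul_le w

theorem csinc_zero : csinc 0 = 1 := by simp [csinc]

theorem csinc_intCast {n : ℤ} (hn : n ≠ 0) : csinc n = 0 := by
  rw [csinc, if_neg (by exact_mod_cast hn), mul_comm (Real.pi : ℂ), Complex.sin_int_mul_pi,
    zero_div]

theorem csinc_neg (w : ℂ) : csinc (-w) = csinc w := by
  simp [csinc]

theorem deriv_csinc_zero : deriv csinc 0 = 0 := by
  have h : deriv csinc 0 = -deriv csinc 0 := by
    conv_lhs => rw [show csinc = fun w => csinc (-w) from funext fun w => (csinc_neg w).symm]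
    rw [deriv_comp_neg]; simp
  exact CharZero.eq_neg_self_iff.1 h

/-! ### A Liouville theorem -/

/-- An entire function of polynomial growth that tends to `0` along the positive imaginary
half-axis vanishes. -/
theorem eq_zero_of_poly_growth {F : Type*} [NormedAddCommGroup F] [NormedSpace ℂ F]
    [CompleteSpace F] (n : ℕ) : ∀ {H : ℂ → F}, Differentiable ℂ H →
    (∃ C : ℝ, ∀ w, ‖H w‖ ≤ C * (1 + ‖w‖) ^ n) →
    Filter.Tendsto (fun y : ℝ => H (y * Complex.I)) Filter.atTop (nhds 0) → ∀ w, H w = 0 := by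
  have const_case : ∀ {H : ℂ → F} (c : F), (∀ z, H z = c) →
      Filter.Tendsto (fun y : ℝ => H (y * Complex.I)) Filter.atTop (nhds 0) → ∀ w, H w = 0 := by
    intro H c hc hlim w
    simp only [hc] at hlim ⊢
    exact tendsto_nhds_unique tendsto_const_nhds hlim
  induction n with
  | zero =>
    rintro H hH ⟨C, hC⟩ hlim
    obtain ⟨c, hc⟩ := hH.exists_const_forall_eq_of_bounded
      (isBounded_iff_forall_norm_le.2 ⟨C, by rintro _ ⟨w, rfl⟩; simpa using hC w⟩)
    exact const_case c hc hlim
  | succ n ih =>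
    rintro H hH ⟨C, hC⟩ hlim
    have hd : Differentiable ℂ (dslope H 0) := by
      rw [← differentiableOn_univ] at hH ⊢
      exact (Complex.differentiableOn_dslope Filter.univ_mem).2 hH
    -- The difference quotient loses one degree of growth and still tends to `0` up the imaginary
    -- axis, so the induction hypothesis makes it vanish and `H` is constant.
    have hz : ∀ w, dslope H 0 w = 0 := by
      refine ih hd ?_ ?_
      · obtain ⟨A, hA⟩ := (isCompact_closedBall (0 : ℂ) 1).exists_bound_of_continuousOn
          hd.continuous.continuousOn
        have hC0 : 0 ≤ C := by have := (norm_nonneg _).trans (hC 0); simpa using this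
        have hA0 : 0 ≤ A := (norm_nonneg _).trans (hA 0 (by simp))
        refine ⟨4 * C + A, fun w => ?_⟩
        have hp : 1 ≤ (1 + ‖w‖) ^ n := one_le_pow₀ (by linarith [norm_nonneg w])
        rcases le_total ‖w‖ 1 with hw | hw
        · have h1 := hA w (by simpa using hw)
          calc ‖dslope H 0 w‖ ≤ A := h1
            _ ≤ (4 * C + A) * 1 := by linarith
            _ ≤ _ := by gcongr
        · have hw0 : w ≠ 0 := by rintro rfl; simp at hw; linarith
          rw [dslope_of_ne _ hw0, slope_def_module, sub_zero, norm_smul, norm_inv,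
            inv_mul_le_iff₀ (by linarith)]
          have h0 : ‖H 0‖ ≤ C := by simpa using hC 0
          have h1 := hC w
          rw [pow_succ] at h1
          have h2 := norm_sub_le (H w) (H 0)
          have h3 : C * ((1 + ‖w‖) ^ n * (1 + ‖w‖)) ≤ C * ((1 + ‖w‖) ^ n * (2 * ‖w‖)) := by
            gcongr; linarith
          have h4 : C * 1 ≤ C * ((1 + ‖w‖) ^ n * ‖w‖) := by
            gcongr; nlinarith
          have h5 : 0 ≤ A * ((1 + ‖w‖) ^ n * ‖w‖) := by positivity
          nlinarith
      · have h1 : Filter.Tendsto (fun y : ℝ => H (y * Complex.I) - H 0) Filter.atTop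
            (nhds (0 - H 0)) := hlim.sub_const _
        have h2 : Filter.Tendsto (fun y : ℝ => ((y : ℂ) * Complex.I)⁻¹) Filter.atTop (nhds 0) := by
          rw [tendsto_zero_iff_norm_tendsto_zero]
          simpa [Function.comp_def] using
            (tendsto_inv_atTop_zero (𝕜 := ℝ)).comp Filter.tendsto_abs_atTop_atTop
        have h3 := h2.smul h1
        rw [zero_smul] at h3
        refine h3.congr' ?_
        filter_upwards [Filter.eventually_gt_atTop 0] with y hy
        have hw0 : (y : ℂ) * Complex.I ≠ 0 := by simp [hy.ne']
        rw [dslope_of_ne _ hw0, slope_def_module, sub_zero]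
    refine const_case (H 0) (fun w => ?_) hlim
    have := sub_smul_dslope H 0 w
    rw [hz w, smul_zero] at this
    exact (sub_eq_zero.1 this.symm)

/-! ### The sinc series: convergence, holomorphy, decay -/

theorem summable_one_div_one_add_abs_int_sq :
    Summable fun k : ℤ => 1 / (1 + |(k : ℝ)|) ^ 2 := by
  have h : Summable fun n : ℕ => 1 / (1 + (n : ℝ)) ^ 2 := by
    have := (summable_nat_add_iff 1).2 (Real.summable_one_div_nat_pow.2 one_lt_two)
    simpa [add_comm] using this
  refine Summable.of_nat_of_neg ?_ ?_ <;> simpa using h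

section SamplingSeries

variable {F : Type*} [NormedAddCommGroup F] [NormedSpace ℂ F] {h : ℂ → F} {C : ℝ}

/-- The first bound keeps the decay in `w - k`, needed as `w → i∞`. The second trades it, through `1
+ |k| ≤ (1 + ‖w‖)(1 + ‖w - k‖)`, for a majorant summable locally uniformly in `w`. -/
theorem exists_norm_csinc_smul_le (hC0 : 0 ≤ C)
    (hC : ∀ w, ‖h w‖ ≤ C * (Real.exp (Real.pi * |w.im|) / (1 + ‖w‖))) :
    ∃ K : ℝ, 0 ≤ K ∧ (∀ (w : ℂ) (k : ℤ), ‖csinc (w - k) • h k‖ ≤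
      K * Real.exp (Real.pi * |w.im|) * (1 / ((1 + ‖w - k‖) * (1 + |(k : ℝ)|)))) ∧
      ∀ (w : ℂ) (k : ℤ), ‖csinc (w - k) • h k‖ ≤
      K * Real.exp (Real.pi * |w.im|) * (1 + ‖w‖) * (1 / (1 + |(k : ℝ)|) ^ 2) := by
  obtain ⟨B, hB0, hB⟩ := exists_norm_csinc_le
  have key : ∀ (w : ℂ) (k : ℤ), ‖csinc (w - k) • h k‖ ≤
      B * C * Real.exp (Real.pi * |w.im|) * (1 / ((1 + ‖w - k‖) * (1 + |(k : ℝ)|))) := by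
    intro w k
    have h1 := hB (w - k)
    have h2 := hC k
    simp only [Complex.sub_im, Complex.intCast_im, sub_zero, abs_zero, mul_zero, Real.exp_zero,
      Complex.norm_intCast] at h1 h2
    rw [norm_smul]
    calc ‖csinc (w - k)‖ * ‖h k‖
        ≤ (B * (Real.exp (Real.pi * |w.im|) / (1 + ‖w - k‖))) * (C * (1 / (1 + |(k : ℝ)|))) := by
          gcongr
      _ = _ := by field_simp
  refine ⟨B * C, by positivity, key, fun w k => (key w k).trans ?_⟩
  rw [mul_assoc _ (1 + ‖w‖)]
  gcongr
  rw [mul_one_div, div_le_div_iff₀ (by positivity) (by positivity)]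
  have h3 : |(k : ℝ)| ≤ ‖w‖ + ‖w - k‖ := by
    have := norm_sub_le w (w - k)
    rwa [sub_sub_cancel, Complex.norm_intCast] at this
  have h4 : 1 + |(k : ℝ)| ≤ (1 + ‖w‖) * (1 + ‖w - k‖) := by
    nlinarith [norm_nonneg w, norm_nonneg (w - k)]
  have h5 : 0 ≤ 1 + |(k : ℝ)| := by positivity
  nlinarith

variable [CompleteSpace F]

theorem summable_csinc_smul (hC0 : 0 ≤ C)
    (hC : ∀ w, ‖h w‖ ≤ C * (Real.exp (Real.pi * |w.im|) / (1 + ‖w‖))) (w : ℂ) :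
    Summable fun k : ℤ => csinc (w - k) • h k := by
  obtain ⟨K, -, -, hK⟩ := exists_norm_csinc_smul_le hC0 hC
  exact .of_norm_bounded (summable_one_div_one_add_abs_int_sq.mul_left _) (hK w)

theorem differentiable_tsum_csinc_smul (hC0 : 0 ≤ C)
    (hC : ∀ w, ‖h w‖ ≤ C * (Real.exp (Real.pi * |w.im|) / (1 + ‖w‖))) :
    Differentiable ℂ fun w => ∑' k : ℤ, csinc (w - k) • h k := by
  obtain ⟨K, hK0, -, hK⟩ := exists_norm_csinc_smul_le hC0 hC
  intro z
  set R := ‖z‖ + 1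
  have hon : DifferentiableOn ℂ (fun w => ∑' k : ℤ, csinc (w - k) • h k) (Metric.ball 0 R) := by
    refine Complex.differentiableOn_tsum_of_summable_norm
      (summable_one_div_one_add_abs_int_sq.mul_left (K * Real.exp (Real.pi * R) * (1 + R)))
      (fun k => ?_) Metric.isOpen_ball fun k w hw => (hK w k).trans ?_
    · exact ((differentiable_csinc.comp (differentiable_id.sub_const _)).smul_const _).differentiableOn
    · have hw' : ‖w‖ ≤ R := by simpa using (Metric.mem_ball.1 hw).le
      have := (Complex.abs_im_le_norm w).trans hw'
      gcongr
  exact hon.differentiableAt (Metric.isOpen_ball.mem_nhds (by simp [R]))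

omit [CompleteSpace F] in
theorem exists_norm_tsum_csinc_smul_le (hC0 : 0 ≤ C)
    (hC : ∀ w, ‖h w‖ ≤ C * (Real.exp (Real.pi * |w.im|) / (1 + ‖w‖))) :
    ∃ K : ℝ, 0 ≤ K ∧ ∀ w, ‖∑' k : ℤ, csinc (w - k) • h k‖ ≤
      K * (1 + ‖w‖) * Real.exp (Real.pi * |w.im|) := by
  obtain ⟨K, hK0, -, hK⟩ := exists_norm_csinc_smul_le hC0 hC
  refine ⟨K * ∑' k : ℤ, 1 / (1 + |(k : ℝ)|) ^ 2, by positivity, fun w => ?_⟩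
  have := tsum_of_norm_bounded (summable_one_div_one_add_abs_int_sq.mul_left _).hasSum (hK w)
  rw [tsum_mul_left] at this
  linarith

omit [CompleteSpace F] in
theorem tsum_csinc_smul_intCast (n : ℤ) : ∑' k : ℤ, csinc ((n : ℂ) - k) • h k = h n := by
  rw [tsum_eq_single n]
  · simp [csinc_zero]
  · intro k hk
    rw [← Int.cast_sub, csinc_intCast (sub_ne_zero.2 hk.symm), zero_smul]

/-- Dominated convergence: each rescaled term is at most `K / y`, and `‖iy - k‖ ≥ |k|` gives a
summable majorant independent of `y`. -/
theorem tendsto_exp_smul_tsum_csinc_smul (hC0 : 0 ≤ C)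
    (hC : ∀ w, ‖h w‖ ≤ C * (Real.exp (Real.pi * |w.im|) / (1 + ‖w‖))) :
    Filter.Tendsto (fun y : ℝ => Real.exp (-(Real.pi * |y|)) •
      ∑' k : ℤ, csinc (y * Complex.I - k) • h k) Filter.atTop (nhds 0) := by
  obtain ⟨K, hK0, hK, -⟩ := exists_norm_csinc_smul_le hC0 hC
  have hK' : ∀ (y : ℝ) (k : ℤ), ‖Real.exp (-(Real.pi * |y|)) • csinc (y * Complex.I - k) • h k‖ ≤
      K * (1 / ((1 + ‖(y * Complex.I - k : ℂ)‖) * (1 + |(k : ℝ)|))) := by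
    intro y k
    have h1 := hK (y * Complex.I) k
    rw [norm_smul, Real.norm_of_nonneg (Real.exp_pos _).le, Real.exp_neg,
      inv_mul_le_iff₀ (Real.exp_pos _)]
    simp only [Complex.mul_im, Complex.ofReal_re, Complex.I_im, mul_one, Complex.ofReal_im,
      Complex.I_re, mul_zero, add_zero] at h1
    linarith
  have hlim := tendsto_tsum_of_dominated_convergence (𝓕 := Filter.atTop)
    (f := fun (y : ℝ) (k : ℤ) => Real.exp (-(Real.pi * |y|)) • csinc (y * Complex.I - k) • h k)
    (g := fun _ => 0) (summable_one_div_one_add_abs_int_sq.mul_left K) ?_ ?_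
  · rw [tsum_zero] at hlim
    refine hlim.congr fun y => ?_
    exact (summable_csinc_smul hC0 hC _).tsum_const_smul _
  · intro k
    refine squeeze_zero_norm' (a := fun y : ℝ => K * y⁻¹) ?_ ?_
    · filter_upwards [Filter.eventually_gt_atTop 0] with y hy
      refine (hK' y k).trans ?_
      rw [one_div]
      gcongr
      have h1 := Complex.abs_im_le_norm (y * Complex.I - k)
      have h2 : (y * Complex.I - k : ℂ).im = y := by simp
      rw [h2, abs_of_pos hy] at h1
      nlinarith [abs_nonneg (k : ℝ), norm_nonneg (y * Complex.I - k : ℂ)]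
    · simpa using (tendsto_inv_atTop_zero (𝕜 := ℝ)).const_mul K
  · refine Filter.Eventually.of_forall fun y k => (hK' y k).trans ?_
    have h1 := Complex.abs_re_le_norm (y * Complex.I - k)
    have h2 : (y * Complex.I - k : ℂ).re = -k := by simp
    rw [h2, abs_neg] at h1
    rw [sq]
    gcongr

end SamplingSeries

/-! ### Division by the sine and the classical sampling theorem -/

/-- Division of an entire function that vanishes on `ℤ` by `sin (π w)`. -/
theorem exists_entire_quotient_sin {F : Type*} [NormedAddCommGroup F] [NormedSpace ℂ F]
    [CompleteSpace F] {G : ℂ → F} (hG : Differentiable ℂ G) (hz : ∀ n : ℤ, G n = 0) :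
    ∃ H : ℂ → F, Differentiable ℂ H ∧ ∀ w, Complex.sin (Real.pi * w) • H w = G w := by
  classical
  have hpi : (Real.pi : ℂ) ≠ 0 := by exact_mod_cast Real.pi_ne_zero
  set s : ℂ → ℂ := fun w => Complex.sin (Real.pi * w) with hs
  have hsd : Differentiable ℂ s := by fun_prop
  have hder : ∀ w, deriv s w = Real.pi * Complex.cos (Real.pi * w) := fun w => by
    have h : HasDerivAt s (Complex.cos (Real.pi * w) * (Real.pi * 1)) w :=
      ((hasDerivAt_id w).const_mul (Real.pi : ℂ)).csin
    rw [h.deriv]; ring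
  have hint : ∀ w, s w = 0 → ∃ n : ℤ, w = n := by
    intro w hw
    obtain ⟨n, hn⟩ := Complex.sin_eq_zero_iff.1 hw
    exact ⟨n, mul_left_cancel₀ hpi (by rw [hn, mul_comm])⟩
  have hder0 : ∀ w, s w = 0 → deriv s w ≠ 0 := by
    intro w hw h0
    have h1 := Complex.sin_sq_add_cos_sq (Real.pi * w)
    rw [hder, mul_eq_zero, or_iff_right hpi] at h0
    rw [h0, show Complex.sin (Real.pi * w) = 0 from hw] at h1
    simp at h1
  set H : ℂ → F := fun w => if s w = 0 then (deriv s w)⁻¹ • deriv G w else (s w)⁻¹ • G w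
    with hH
  refine ⟨H, fun c => ?_, fun w => ?_⟩
  · by_cases hc : s c = 0
    · have hGc : G c = 0 := by obtain ⟨n, rfl⟩ := hint c hc; exact hz n
      have hds : Differentiable ℂ (dslope s c) := by
        rw [← differentiableOn_univ] at hsd ⊢
        exact (Complex.differentiableOn_dslope Filter.univ_mem).2 hsd
      have hdG : Differentiable ℂ (dslope G c) := by
        rw [← differentiableOn_univ] at hG ⊢
        exact (Complex.differentiableOn_dslope Filter.univ_mem).2 hG
      have hne : dslope s c c ≠ 0 := by rw [dslope_same]; exact hder0 c hc
      -- The zeros of the sine are simple, so the common factor `w - c` cancels.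
      have hev : H =ᶠ[nhds c] fun w => (dslope s c w)⁻¹ • dslope G c w := by
        filter_upwards [hds.continuous.continuousAt.eventually_ne hne] with w hw
        rcases eq_or_ne w c with rfl | hwc
        · simp [hH, hc]
        · have h1 := sub_smul_dslope_of_zero hc w
          have h2 := sub_smul_dslope_of_zero hGc w
          have h3 : w - c ≠ 0 := sub_ne_zero.2 hwc
          rw [smul_eq_mul] at h1
          have h4 : s w ≠ 0 := by rw [← h1]; exact mul_ne_zero h3 hw
          simp only [hH, if_neg h4]
          rw [← h1, ← h2, smul_smul]
          congr 1
          field_simp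
      exact (((hds c).inv hne).smul (hdG c)).congr_of_eventuallyEq hev
    · have hev : H =ᶠ[nhds c] fun w => (s w)⁻¹ • G w := by
        filter_upwards [hsd.continuous.continuousAt.eventually_ne hc] with w hw
        simp only [hH, if_neg hw]
      exact (((hsd c).inv hc).smul (hG c)).congr_of_eventuallyEq hev
  · by_cases hw : s w = 0
    · obtain ⟨n, rfl⟩ := hint w hw
      rw [hz]
      exact (congrArg (· • _) hw).trans (zero_smul _ _)
    · simp only [hH, if_neg hw]
      exact smul_inv_smul₀ hw _

/-- An entire function whose product with `|Im w|` grows polynomially grows polynomially. -/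
theorem exists_poly_growth_of_im_mul {F : Type*} [NormedAddCommGroup F] [NormedSpace ℂ F]
    {H : ℂ → F} (hH : Differentiable ℂ H) {C : ℝ} {n : ℕ}
    (hC : ∀ w, |w.im| * ‖H w‖ ≤ C * (1 + ‖w‖) ^ n) :
    ∃ A : ℝ, ∀ w, ‖H w‖ ≤ A * (1 + ‖w‖) ^ n := by
  have hC0 : 0 ≤ C := by
    have : 0 ≤ C * (1 + ‖(0 : ℂ)‖) ^ n := le_trans (by positivity) (hC 0)
    simpa using this
  refine ⟨C * 3 ^ n * 2, fun w => ?_⟩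
  -- On `‖z‖ = R` one has `|z² - R²| = 2R |Im z|`, so multiplying `H` by `z² - R²` brings in the
  -- hypothesis on the circle. The maximum principle carries the bound to `w`, where `|w² - R²| ≥
  -- R`.
  set R : ℝ := 1 + 2 * ‖w‖
  have hR : 1 ≤ R := by simp [R]
  have hb : ∀ z ∈ frontier (Metric.ball (0 : ℂ) R),
      ‖(z ^ 2 - (R : ℂ) ^ 2) • H z‖ ≤ 2 * R * (C * (1 + R) ^ n) := by
    intro z hz
    rw [frontier_ball _ (by linarith), mem_sphere_zero_iff_norm] at hz
    have h1 : z ^ 2 - (R : ℂ) ^ 2 = z * (2 * z.im * Complex.I) := by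
      rw [← hz, ← Complex.mul_conj', sq, ← mul_sub, Complex.sub_conj]
      push_cast; ring
    have h2 := hC z
    rw [hz] at h2
    rw [h1, norm_smul, norm_mul, norm_mul, norm_mul, Complex.norm_I, hz, Complex.norm_real,
      Complex.norm_ofNat, Real.norm_eq_abs]
    nlinarith
  have hd : Differentiable ℂ fun z : ℂ => (z ^ 2 - (R : ℂ) ^ 2) • H z := by fun_prop
  have h1 := Complex.norm_le_of_forall_mem_frontier_norm_le Metric.isBounded_ball
    hd.diffContOnCl hb (z := w) (subset_closure (by simp [R]; linarith [norm_nonneg w]))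
  rw [norm_smul] at h1
  have h2 : R ≤ ‖w ^ 2 - (R : ℂ) ^ 2‖ := by
    have h3 := norm_sub_norm_le ((R : ℂ) ^ 2) (w ^ 2)
    rw [norm_sub_rev, norm_pow, norm_pow, Complex.norm_real, Real.norm_of_nonneg (by linarith)]
      at h3
    refine le_trans ?_ h3
    have : ‖w‖ = (R - 1) / 2 := by simp [R]
    rw [this]; nlinarith
  have h3 : R * ‖H w‖ ≤ R * (2 * (C * (1 + R) ^ n)) := by
    calc R * ‖H w‖ ≤ ‖w ^ 2 - (R : ℂ) ^ 2‖ * ‖H w‖ := by gcongr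
      _ ≤ _ := h1
      _ = _ := by ring
  have h4 := le_of_mul_le_mul_left h3 (by linarith)
  have h5 : (1 + R) ^ n ≤ (3 * (1 + ‖w‖)) ^ n := by
    gcongr; simp only [R]; linarith [norm_nonneg w]
  rw [mul_pow] at h5
  calc ‖H w‖ ≤ 2 * (C * (1 + R) ^ n) := h4
    _ ≤ 2 * (C * (3 ^ n * (1 + ‖w‖) ^ n)) := by gcongr
    _ = _ := by ring

/-- The classical sampling theorem for entire functions of exponential type `π` that are
`O(1 / |x|)` on the real line. -/
theorem hasSum_csinc_smul {F : Type*} [NormedAddCommGroup F] [NormedSpace ℂ F]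
    [CompleteSpace F] {h : ℂ → F} {C : ℝ} (hd : Differentiable ℂ h) (hC0 : 0 ≤ C)
    (hC : ∀ w, ‖h w‖ ≤ C * (Real.exp (Real.pi * |w.im|) / (1 + ‖w‖))) (w : ℂ) :
    HasSum (fun k : ℤ => csinc (w - k) • h k) (h w) := by
  set T : ℂ → F := fun w => ∑' k : ℤ, csinc (w - k) • h k with hT
  have hTd : Differentiable ℂ T := differentiable_tsum_csinc_smul hC0 hC
  obtain ⟨K, hK0, hK⟩ := exists_norm_tsum_csinc_smul_le hC0 hC
  obtain ⟨H, hHd, hH⟩ := exists_entire_quotient_sin (hd.sub hTd) fun n => by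
    simp [hT, tsum_csinc_smul_intCast]
  have hgrow : ∀ w, |w.im| * ‖H w‖ ≤ 8 * (C + K) * (1 + ‖w‖) ^ 2 := by
    intro w
    have hG : ‖(h - T) w‖ ≤ (C + K) * (1 + ‖w‖) * Real.exp (Real.pi * |w.im|) := by
      have h1 : ‖h w‖ ≤ C * (Real.exp (Real.pi * |w.im|) * (1 + ‖w‖)) := by
        refine (hC w).trans ?_
        gcongr
        rw [div_le_iff₀ (by positivity), mul_assoc]
        exact le_mul_of_one_le_right (Real.exp_pos _).le (by nlinarith [norm_nonneg w])
      have h2 := hK w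
      calc ‖(h - T) w‖ ≤ ‖h w‖ + ‖T w‖ := norm_sub_le _ _
        _ ≤ _ := add_le_add h1 h2
        _ = _ := by ring
    have h1 := abs_im_mul_exp_le w
    have h2 : 1 + 2 * (Real.pi * |w.im|) ≤ 8 * (1 + ‖w‖) := by
      nlinarith [Real.pi_lt_four, Complex.abs_im_le_norm w, abs_nonneg w.im]
    rcases eq_or_lt_of_le (norm_nonneg (Complex.sin (Real.pi * w))) with h0 | h0
    · have h3 : |w.im| = 0 := by
        rw [← h0, mul_zero] at h1
        nlinarith [Real.exp_pos (Real.pi * |w.im|), abs_nonneg w.im]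
      rw [h3, zero_mul]; positivity
    · rw [← hH, norm_smul] at hG
      refine le_of_mul_le_mul_left ?_ h0
      calc ‖Complex.sin (Real.pi * w)‖ * (|w.im| * ‖H w‖)
          = |w.im| * (‖Complex.sin (Real.pi * w)‖ * ‖H w‖) := by ring
        _ ≤ |w.im| * ((C + K) * (1 + ‖w‖) * Real.exp (Real.pi * |w.im|)) := by gcongr
        _ = (C + K) * (1 + ‖w‖) * (|w.im| * Real.exp (Real.pi * |w.im|)) := by ring
        _ ≤ (C + K) * (1 + ‖w‖) * ((8 * (1 + ‖w‖)) * ‖Complex.sin (Real.pi * w)‖) := by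
          exact mul_le_mul_of_nonneg_left (h1.trans (by gcongr)) (by positivity)
        _ = _ := by ring
  have hlim : Filter.Tendsto (fun y : ℝ => H (y * Complex.I)) Filter.atTop (nhds 0) := by
    have h1 : Filter.Tendsto (fun y : ℝ => Real.exp (-(Real.pi * |y|)) • h (y * Complex.I))
        Filter.atTop (nhds 0) := by
      refine squeeze_zero_norm' (a := fun y : ℝ => C * y⁻¹) ?_ ?_
      · filter_upwards [Filter.eventually_gt_atTop 0] with y hy
        have h1 := hC (y * Complex.I)
        simp only [Complex.mul_im, Complex.ofReal_re, Complex.I_im, mul_one, Complex.ofReal_im,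
          Complex.I_re, mul_zero, add_zero, norm_mul, Complex.norm_I, Complex.norm_real,
          Real.norm_eq_abs] at h1
        rw [norm_smul, Real.norm_of_nonneg (Real.exp_pos _).le, Real.exp_neg,
          inv_mul_le_iff₀ (Real.exp_pos _)]
        refine h1.trans ?_
        rw [mul_left_comm, div_eq_mul_inv, abs_of_pos hy]
        gcongr
        linarith
      · simpa using (tendsto_inv_atTop_zero (𝕜 := ℝ)).const_mul C
    have h2 := (h1.sub (tendsto_exp_smul_tsum_csinc_smul hC0 hC)).norm.const_mul (9 : ℝ)
    simp only [sub_zero, norm_zero, mul_zero, ← smul_sub] at h2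
    refine squeeze_zero_norm' ?_ h2
    filter_upwards [Filter.eventually_ge_atTop 1] with y hy
    have h3 := abs_im_mul_exp_le (y * Complex.I)
    have h4 : (y * Complex.I : ℂ).im = y := by simp
    have hy0 : |y| = y := abs_of_pos (by linarith)
    rw [h4, hy0] at h3
    -- The constant 9 comes from `2π < 8` and `1 ≤ y`.
    have h5 : 1 + 2 * (Real.pi * y) ≤ 9 * y := by nlinarith [Real.pi_lt_four]
    have h6 : Real.exp (Real.pi * y) ≤ 9 * ‖Complex.sin (Real.pi * (y * Complex.I))‖ := by
      refine le_of_mul_le_mul_left (h3.trans ?_) (by linarith : 0 < y)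
      linarith [mul_le_mul_of_nonneg_right h5
        (norm_nonneg (Complex.sin (Real.pi * (y * Complex.I))))]
    have h7 := hH (y * Complex.I)
    rw [show h (y * Complex.I) - ∑' k : ℤ, csinc (y * Complex.I - k) • h k =
      (h - T) (y * Complex.I) from rfl, ← h7, norm_smul, norm_smul, hy0,
      Real.norm_of_nonneg (Real.exp_pos _).le, Real.exp_neg]
    rw [← mul_assoc, ← mul_assoc]
    refine le_mul_of_one_le_left (norm_nonneg _) ?_
    rw [mul_right_comm, ← div_eq_mul_inv, one_le_div (Real.exp_pos _)]
    exact h6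
  have hzero := eq_zero_of_poly_growth 2 hHd (exists_poly_growth_of_im_mul hHd hgrow) hlim w
  have h1 := hH w
  rw [hzero, smul_zero] at h1
  have h2 : h w = T w := (sub_eq_zero.1 h1.symm)
  rw [h2]
  exact (summable_csinc_smul hC0 hC w).hasSum

/-! ### Sampling without decay -/

/-- The sampling formula for entire functions of exponential type `π` that are bounded on the
real line. -/
theorem sampling_formula {F : Type*} [NormedAddCommGroup F] [NormedSpace ℂ F]
    [CompleteSpace F] {g : ℂ → F} {C : ℝ} (hg : Differentiable ℂ g)
    (hC : ∀ w, ‖g w‖ ≤ C * Real.exp (Real.pi * |w.im|)) (w : ℂ) :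
    (Summable fun k : {k : ℤ // k ≠ 0} =>
      (w / ((k : ℤ) : ℂ) * csinc (w - ((k : ℤ) : ℂ))) • g ((k : ℤ) : ℂ)) ∧
    g w = (w * csinc w) • deriv g 0 + csinc w • g 0 +
      ∑' k : {k : ℤ // k ≠ 0},
        (w / ((k : ℤ) : ℂ) * csinc (w - ((k : ℤ) : ℂ))) • g ((k : ℤ) : ℂ) := by
  set G : ℂ → F := fun w => g w - csinc w • g 0 with hG
  have hGd : Differentiable ℂ G := hg.sub (differentiable_csinc.smul_const _)
  have hG0 : G 0 = 0 := by simp [hG, csinc_zero]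
  obtain ⟨B, hB0, hB⟩ := exists_norm_csinc_le
  have hGb : ∀ w, ‖G w‖ ≤ (C + B * ‖g 0‖) * Real.exp (Real.pi * |w.im|) := by
    intro w
    have h1 : ‖csinc w‖ ≤ B * Real.exp (Real.pi * |w.im|) := by
      refine (hB w).trans ?_
      gcongr
      exact div_le_self (Real.exp_pos _).le (by linarith [norm_nonneg w])
    calc ‖G w‖ ≤ ‖g w‖ + ‖csinc w‖ * ‖g 0‖ := by
          rw [← norm_smul]; exact norm_sub_le _ _
      _ ≤ C * Real.exp (Real.pi * |w.im|) + B * Real.exp (Real.pi * |w.im|) * ‖g 0‖ := by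
          gcongr
          exact hC w
      _ = _ := by ring
  obtain ⟨A, hA0, hA⟩ := exists_norm_dslope_le hGd hGb
  have hd : Differentiable ℂ (dslope G 0) := by
    rw [← differentiableOn_univ] at hGd ⊢
    exact (Complex.differentiableOn_dslope Filter.univ_mem).2 hGd
  have hsum := (hasSum_csinc_smul hd hA0 hA w).const_smul w
  have hw : w • dslope G 0 w = G w := by simpa using sub_smul_dslope_of_zero hG0 w
  rw [hw] at hsum
  have hterm : ∀ k : ℤ, k ≠ 0 → w • csinc (w - k) • dslope G 0 k =
      (w / (k : ℂ) * csinc (w - k)) • g k := by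
    intro k hk
    have hk' : (k : ℂ) ≠ 0 := by exact_mod_cast hk
    have h1 : G k = g k := by simp [hG, csinc_intCast hk]
    rw [dslope_of_ne _ hk', slope_def_module, hG0, sub_zero, sub_zero, h1, smul_smul, smul_smul]
    congr 1
    ring
  -- The `k = 0` sample yields the derivative term; `csinc` is even, so the subtracted part
  -- contributes nothing.
  have hzero : dslope G 0 0 = deriv g 0 := by
    rw [dslope_same, hG, deriv_fun_sub (hg 0) ((differentiable_csinc 0).smul_const _),
      deriv_smul_const (differentiable_csinc 0), deriv_csinc_zero, zero_smul, sub_zero]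
  have hsub : Summable fun k : {k : ℤ // k ≠ 0} =>
      (w / ((k : ℤ) : ℂ) * csinc (w - ((k : ℤ) : ℂ))) • g ((k : ℤ) : ℂ) :=
    (hsum.summable.subtype {k : ℤ | k ≠ 0}).congr fun k => hterm k.1 k.2
  refine ⟨hsub, ?_⟩
  have h1 := hsum.summable.tsum_eq_add_tsum_ite 0
  rw [hsum.tsum_eq] at h1
  have h2 : ∑' k : {k : ℤ // k ≠ 0},
      (w / ((k : ℤ) : ℂ) * csinc (w - ((k : ℤ) : ℂ))) • g ((k : ℤ) : ℂ) =
      ∑' k : ℤ, if k = 0 then 0 else w • csinc (w - k) • dslope G 0 k := by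
    have h3 := tsum_subtype {k : ℤ | k ≠ 0} fun k : ℤ => w • csinc (w - k) • dslope G 0 k
    refine (tsum_congr fun k : {k : ℤ // k ≠ 0} => (hterm k.1 k.2).symm).trans
      (h3.trans (tsum_congr fun k => ?_))
    by_cases hk : k = 0 <;> simp [hk]
  rw [h2, ← sub_eq_iff_eq_add'.2 h1]
  simp only [Int.cast_zero, sub_zero, hzero, smul_smul]
  simp only [hG]
  abel

/-! ### Orbits of the group and Taylor's formula -/

section Generator

variable {E : Type*} [NormedAddCommGroup E] [NormedSpace ℂ E]

/-- Ensures that the default value in `opApply` never enters the iterates used below. -/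
theorem opPow_mem_domain {D : E →ₗ.[ℂ] E} {k : ℕ} :
    ∀ {f : E}, f ∈ powDomain D (k + 1) → opPow D k f ∈ D.domain := by
  induction k with
  | zero => rintro f ⟨h, -⟩; exact h
  | succ k ih =>
    rintro f ⟨h, h'⟩
    have := ih h'
    rwa [opPow, Function.iterate_succ_apply, opApply, dif_pos h]

theorem opPow_succ (D : E →ₗ.[ℂ] E) (k : ℕ) (f : E) :
    opPow D (k + 1) f = opApply D (opPow D k f) :=
  Function.iterate_succ_apply' _ _ _

theorem IsBoundedC0Group.hasDerivAt {U : ℝ → E →L[ℂ] E} (hU : IsBoundedC0Group U) {f : E}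
    (hf : f ∈ (generator U).domain) (s : ℝ) :
    HasDerivAt (fun t => U t f) (U s (opApply (generator U) f)) s := by
  have hf' : DifferentiableAt ℝ (fun t : ℝ => U t f) 0 := hf
  have h0 : HasDerivAt (fun t => U t f) (opApply (generator U) f) (s - s) := by
    rw [opApply, dif_pos hf, sub_self]
    exact hf'.hasDerivAt
  have h1 := ((U s).restrictScalars ℝ).hasFDerivAt.comp_hasDerivAt s (h0.comp_sub_const s s)
  refine h1.congr_of_eventuallyEq (Filter.Eventually.of_forall fun t => ?_)
  have := congrArg (· f) (hU.map_add s (t - s))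
  simpa using this

/-- The Taylor polynomial of order `n + 1` at `s` of a trajectory, as a function of `s`. -/
theorem IsBoundedC0Group.hasDerivAt_taylor {U : ℝ → E →L[ℂ] E} {a : ℕ → E}
    (ha : ∀ k s, HasDerivAt (fun t : ℝ => U t (a k)) (U s (a (k + 1))) s) (t : ℝ) (n : ℕ) (s : ℝ) :
    HasDerivAt (fun s => ∑ r ∈ Finset.range (n + 1), ((t - s) ^ r / r.factorial) • U s (a r))
      (((t - s) ^ n / n.factorial) • U s (a (n + 1))) s := by
  induction n with
  | zero => simpa using ha 0 s
  | succ n ih =>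
    have h1 : HasDerivAt (fun s => (t - s) ^ (n + 1) / ((n + 1).factorial : ℝ))
        (-((t - s) ^ n / n.factorial)) s := by
      have := (((hasDerivAt_id s).const_sub t).pow (n + 1)).div_const ((n + 1).factorial : ℝ)
      refine this.congr_deriv ?_
      have : (n.factorial : ℝ) ≠ 0 := by positivity
      simp only [Nat.factorial_succ, Nat.cast_mul, id, Nat.add_sub_cancel]
      field_simp
    have h2 := ih.add (h1.smul (ha (n + 1) s))
    simp only [Finset.sum_range_succ _ (n + 1)]
    refine h2.congr_deriv ?_
    rw [neg_smul]
    abel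

/-- The Taylor polynomial based at `s` runs from the polynomial at `s = 0` to `U t (a 0)` at `s =
t`. Its derivative in `s` telescopes to one term, so the mean value inequality replaces an integral
remainder. -/
theorem IsBoundedC0Group.norm_sub_taylor_le {U : ℝ → E →L[ℂ] E} (hU : IsBoundedC0Group U)
    {a : ℕ → E} (ha : ∀ k s, HasDerivAt (fun t : ℝ => U t (a k)) (U s (a (k + 1))) s)
    {M : ℝ} (hM : ∀ t, ‖U t‖ ≤ M) (t : ℝ) (n : ℕ) :
    ‖U t (a 0) - ∑ r ∈ Finset.range (n + 1), (t ^ r / r.factorial) • a r‖ ≤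
      |t| ^ n / n.factorial * (M * ‖a (n + 1)‖) * |t| := by
  have h := Convex.norm_image_sub_le_of_norm_hasDerivWithin_le (s := Set.uIcc 0 t) (x := 0) (y := t)
    (C := |t| ^ n / n.factorial * (M * ‖a (n + 1)‖))
    (fun s _ => (IsBoundedC0Group.hasDerivAt_taylor ha t n s).hasDerivWithinAt) (fun s hs => ?_)
    (convex_uIcc _ _) Set.left_mem_uIcc Set.right_mem_uIcc
  · have h1 : ∑ r ∈ Finset.range (n + 1), ((t - t) ^ r / (r.factorial : ℝ)) • U t (a r) =
        U t (a 0) := by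
      rw [Finset.sum_range_succ', Finset.sum_eq_zero] <;> simp
    have h2 : ∀ x, U 0 x = x := fun x => by rw [hU.map_zero]; rfl
    simp only [h1, h2, sub_zero] at h
    simpa using h
  · rw [norm_smul, norm_div, norm_pow, Real.norm_eq_abs, Real.norm_of_nonneg (by positivity)]
    have h1 : |t - s| ≤ |t| := by
      simpa using Set.abs_sub_right_of_mem_uIcc hs
    have h2 := (U s).le_of_opNorm_le (hM s) (a (n + 1))
    gcongr

end Generator

/-! ### Bernstein vectors and their entire trajectories -/

section Bernstein

variable {E : Type*} [NormedAddCommGroup E] [NormedSpace ℂ E]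
  {U : ℝ → E →L[ℂ] E} {σ : ℝ} {f : E}

theorem norm_expOp_term_le (hf : f ∈ bernsteinSpace (generator U) σ) (z : ℂ) (r : ℕ) :
    ‖(z ^ r / (Nat.factorial r : ℂ)) • opPow (generator U) r f‖ ≤
      (σ * ‖z‖) ^ r / r.factorial * ‖f‖ := by
  rw [norm_smul, norm_div, norm_pow, Complex.norm_natCast, mul_pow]
  calc ‖z‖ ^ r / r.factorial * ‖opPow (generator U) r f‖
      ≤ ‖z‖ ^ r / r.factorial * (σ ^ r * ‖f‖) := by gcongr; exact hf.2 r
    _ = _ := by ring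

theorem norm_expOp_le (hf : f ∈ bernsteinSpace (generator U) σ) (z : ℂ) :
    ‖expOp (generator U) z f‖ ≤ Real.exp (σ * ‖z‖) * ‖f‖ := by
  refine tsum_of_norm_bounded ?_ (norm_expOp_term_le hf z)
  rw [Real.exp_eq_exp_ℝ]
  exact (NormedSpace.expSeries_div_hasSum_exp (σ * ‖z‖)).mul_right _

theorem opPow_hasDerivAt (hU : IsBoundedC0Group U) (hf : f ∈ bernsteinSpace (generator U) σ)
    (k : ℕ) (s : ℝ) : HasDerivAt (fun t : ℝ => U t (opPow (generator U) k f))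
      (U s (opPow (generator U) (k + 1) f)) s := by
  rw [opPow_succ]
  exact hU.hasDerivAt (opPow_mem_domain (hf.1 (k + 1))) s

variable [CompleteSpace E]

theorem summable_expOp (hf : f ∈ bernsteinSpace (generator U) σ) (z : ℂ) :
    Summable fun r : ℕ => (z ^ r / (Nat.factorial r : ℂ)) • opPow (generator U) r f :=
  .of_norm_bounded ((Real.summable_pow_div_factorial _).mul_right _) (norm_expOp_term_le hf z)

theorem differentiable_expOp (hσ : 0 ≤ σ) (hf : f ∈ bernsteinSpace (generator U) σ) :
    Differentiable ℂ fun z => expOp (generator U) z f := by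
  intro z
  have hon : DifferentiableOn ℂ (fun z => expOp (generator U) z f)
      (Metric.ball 0 (‖z‖ + 1)) := by
    refine Complex.differentiableOn_tsum_of_summable_norm
      ((Real.summable_pow_div_factorial (σ * (‖z‖ + 1))).mul_right ‖f‖)
      (fun r => by fun_prop) Metric.isOpen_ball fun r w hw => (norm_expOp_term_le hf w r).trans ?_
    have hw' : ‖w‖ ≤ ‖z‖ + 1 := by simpa using (Metric.mem_ball.1 hw).le
    gcongr
  exact hon.differentiableAt (Metric.isOpen_ball.mem_nhds (by simp))

theorem expOp_ofReal (hU : IsBoundedC0Group U) (hf : f ∈ bernsteinSpace (generator U) σ) (t : ℝ) :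
    expOp (generator U) (t : ℂ) f = U t f := by
  obtain ⟨M, hM⟩ := hU.bounded
  have hM0 : 0 ≤ M := (norm_nonneg _).trans (hM 0)
  have h1 := (summable_expOp hf t).hasSum.tendsto_sum_nat.comp (Filter.tendsto_add_atTop_nat 1)
  refine tendsto_nhds_unique h1 ?_
  rw [tendsto_iff_norm_sub_tendsto_zero]
  have h2 : Filter.Tendsto (fun n : ℕ => (|t| * σ) ^ n / n.factorial * (M * σ * ‖f‖ * |t|))
      Filter.atTop (nhds 0) := by
    simpa using (FloorSemiring.tendsto_pow_div_factorial_atTop (|t| * σ)).mul_const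
      (M * σ * ‖f‖ * |t|)
  refine squeeze_zero (fun _ => norm_nonneg _) (fun n => ?_) h2
  have h3 := hU.norm_sub_taylor_le (opPow_hasDerivAt hU hf) hM t n
  rw [norm_sub_rev]
  have h4 : ∀ r : ℕ, (t ^ r / (r.factorial : ℝ)) • opPow (generator U) r f =
      ((t : ℂ) ^ r / (r.factorial : ℂ)) • opPow (generator U) r f := fun r => by
    rw [← Complex.coe_smul]; push_cast; rfl
  simp only [h4] at h3
  refine h3.trans ?_
  calc |t| ^ n / n.factorial * (M * ‖opPow (generator U) (n + 1) f‖) * |t|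
      ≤ |t| ^ n / n.factorial * (M * (σ ^ (n + 1) * ‖f‖)) * |t| := by
        gcongr; exact hf.2 (n + 1)
    _ = _ := by ring

/-- Both sides are entire in `z` and agree for real `z` by the group law, so the identity theorem
applies. -/
theorem expOp_ofReal_add (hU : IsBoundedC0Group U) (hσ : 0 ≤ σ)
    (hf : f ∈ bernsteinSpace (generator U) σ) (t : ℝ) (z : ℂ) :
    expOp (generator U) (t + z) f = U t (expOp (generator U) z f) := by
  have hd := differentiable_expOp hσ hf
  have hl : Differentiable ℂ fun z : ℂ => expOp (generator U) (t + z) f :=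
    hd.comp (differentiable_id.const_add (t : ℂ))
  have hr : Differentiable ℂ fun z => U t (expOp (generator U) z f) :=
    (U t).differentiable.comp hd
  have hreal : ∀ s : ℝ, expOp (generator U) (t + (s : ℂ)) f =
      U t (expOp (generator U) (s : ℂ) f) := fun s => by
    rw [← Complex.ofReal_add, expOp_ofReal hU hf, expOp_ofReal hU hf, hU.map_add]; rfl
  refine congrFun (AnalyticOnNhd.eq_of_frequently_eq (z₀ := 0)
    (fun w _ => hl.analyticAt w) (fun w _ => hr.analyticAt w) ?_) z
  have hlim : Filter.Tendsto (fun s : ℝ => (s : ℂ)) (nhdsWithin 0 {0}ᶜ)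
      (nhdsWithin 0 {0}ᶜ) := by
    refine tendsto_nhdsWithin_iff.2 ⟨?_, ?_⟩
    · exact (Complex.continuous_ofReal.tendsto' 0 0 (by simp)).mono_left nhdsWithin_le_nhds
    · filter_upwards [self_mem_nhdsWithin] with s hs
      simpa using hs
  exact hlim.frequently (Filter.Eventually.of_forall hreal).frequently

/-- Split `z = x + iy`: `U x` costs only the uniform bound of the group, and the power series at
`iy` costs `exp (σ |y|)`. No Phragmén–Lindelöf argument is needed. -/
theorem exists_norm_expOp_le (hU : IsBoundedC0Group U) (hσ : 0 ≤ σ)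
    (hf : f ∈ bernsteinSpace (generator U) σ) :
    ∃ C : ℝ, ∀ z : ℂ, ‖expOp (generator U) z f‖ ≤ C * Real.exp (σ * |z.im|) := by
  obtain ⟨M, hM⟩ := hU.bounded
  have hM0 : 0 ≤ M := (norm_nonneg _).trans (hM 0)
  refine ⟨M * ‖f‖, fun z => ?_⟩
  rw [← Complex.re_add_im z, expOp_ofReal_add hU hσ hf]
  refine ((U z.re).le_of_opNorm_le (hM _) _).trans ?_
  have h := norm_expOp_le hf (z.im * Complex.I)
  rw [norm_mul, Complex.norm_I, mul_one, Complex.norm_real, Real.norm_eq_abs] at h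
  simp only [Complex.re_add_im]
  rw [mul_right_comm, mul_assoc]
  gcongr

theorem deriv_expOp_zero (hU : IsBoundedC0Group U) (hσ : 0 ≤ σ)
    (hf : f ∈ bernsteinSpace (generator U) σ) :
    deriv (fun z => expOp (generator U) z f) 0 = opApply (generator U) f := by
  have h1 : HasDerivAt (fun z => expOp (generator U) z f)
      (deriv (fun z => expOp (generator U) z f) 0) ((0 : ℝ) : ℂ) := by
    rw [Complex.ofReal_zero]; exact (differentiable_expOp hσ hf 0).hasDerivAt
  have h2 := h1.scomp (0 : ℝ) (Complex.ofRealCLM.hasDerivAt (x := 0))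
  simp only [Function.comp_def, Complex.ofRealCLM_apply, expOp_ofReal hU hf, Complex.ofReal_one,
    one_smul] at h2
  have h3 := opPow_hasDerivAt hU hf 0 0
  rw [hU.map_zero] at h3
  exact h2.unique h3

end Bernstein

theorem mainTheorem3 {E : Type*} [NormedAddCommGroup E] [NormedSpace ℂ E] [CompleteSpace E]
    (U : ℝ → E →L[ℂ] E) (hU : IsBoundedC0Group U)
    (σ : ℝ) (hσ : 0 < σ) (f : E) (hf : f ∈ bernsteinSpace (generator U) σ) :
    -- the power series that defines `e^{zD} f` converges and is an entire extension of `U t f`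
    (∀ z : ℂ, Summable fun r : ℕ =>
      (z ^ r / (Nat.factorial r : ℂ)) • opPow (generator U) r f) ∧
    (Differentiable ℂ fun z : ℂ => expOp (generator U) z f) ∧
    (∀ t : ℝ, expOp (generator U) (t : ℂ) f = U t f) ∧
    -- the sampling series converges and the sampling formula holds
    ∀ z : ℂ,
      (Summable fun k : {k : ℤ // k ≠ 0} =>
        ((σ : ℂ) * z / (((k : ℤ) : ℂ) * (Real.pi : ℂ)) *
          csinc ((σ : ℂ) * z / (Real.pi : ℂ) - ((k : ℤ) : ℂ))) •
            U (((k : ℤ) : ℝ) * Real.pi / σ) f) ∧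
      expOp (generator U) z f =
        (z * csinc ((σ : ℂ) * z / (Real.pi : ℂ))) • opApply (generator U) f +
        csinc ((σ : ℂ) * z / (Real.pi : ℂ)) • f +
        ∑' k : {k : ℤ // k ≠ 0},
          ((σ : ℂ) * z / (((k : ℤ) : ℂ) * (Real.pi : ℂ)) *
            csinc ((σ : ℂ) * z / (Real.pi : ℂ) - ((k : ℤ) : ℂ))) •
              U (((k : ℤ) : ℝ) * Real.pi / σ) f := by
  refine ⟨summable_expOp hf, differentiable_expOp hσ.le hf, expOp_ofReal hU hf, fun z => ?_⟩
  have hpi : (Real.pi : ℂ) ≠ 0 := by exact_mod_cast Real.pi_ne_zero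
  have hσ' : (σ : ℂ) ≠ 0 := by exact_mod_cast hσ.ne'
  obtain ⟨C, hC⟩ := exists_norm_expOp_le hU hσ.le hf
  have hd := differentiable_expOp hσ.le hf
  -- Rescaling by `π / σ` turns type `σ` into type `π` and the nodes `kπ / σ` into integers; the
  -- factor `c` from the chain rule cancels against `σ z / π`, leaving `z`.
  set c : ℝ := Real.pi / σ with hc
  have hcc : (c : ℂ) = Real.pi / σ := by simp [hc]
  have hc0 : 0 < c := by positivity
  have hgd : Differentiable ℂ fun w : ℂ => expOp (generator U) (c * w) f :=
    hd.comp (differentiable_id.const_mul (c : ℂ))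
  have hgC : ∀ w : ℂ, ‖expOp (generator U) (c * w) f‖ ≤ C * Real.exp (Real.pi * |w.im|) := by
    intro w
    have h := hC (c * w)
    rwa [Complex.im_ofReal_mul, abs_mul, abs_of_pos hc0, ← mul_assoc,
      show σ * c = Real.pi by rw [hc]; field_simp] at h
  have hderiv : deriv (fun w : ℂ => expOp (generator U) (c * w) f) 0 =
      (c : ℂ) • opApply (generator U) f := by
    rw [deriv_comp_mul_left (c : ℂ) (fun z => expOp (generator U) z f) 0, mul_zero,
      deriv_expOp_zero hU hσ.le hf]
  obtain ⟨hsum, heq⟩ := sampling_formula hgd hgC ((σ : ℂ) * z / (Real.pi : ℂ))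
  have hint : ∀ k : ℤ, expOp (generator U) ((c : ℂ) * (k : ℂ)) f =
      U ((k : ℝ) * Real.pi / σ) f := by
    intro k
    rw [← expOp_ofReal hU hf, hcc]
    congr 1
    push_cast
    ring
  have hcz : (c : ℂ) * ((σ : ℂ) * z / (Real.pi : ℂ)) = z := by rw [hcc]; field_simp
  have hzero : expOp (generator U) ((c : ℂ) * 0) f = f := by
    have h := hint 0
    simpa [hU.map_zero] using h
  have hterm : ∀ k : {k : ℤ // k ≠ 0}, (σ : ℂ) * z / (Real.pi : ℂ) / ((k : ℤ) : ℂ) =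
      (σ : ℂ) * z / (((k : ℤ) : ℂ) * (Real.pi : ℂ)) := fun k => by
    rw [div_div, mul_comm (Real.pi : ℂ)]
  simp only [hint, hterm] at hsum heq
  refine ⟨hsum, ?_⟩
  rw [hcz, hderiv, hzero, smul_smul] at heq
  rw [heq]
  congr 3
  rw [mul_right_comm, mul_comm _ (c : ℂ), hcz]
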